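/- **Definitions.** A *1-way quantum finite automaton* (QFA) over a finite alphabet $\Sigma$ consists of a finite set $Q$ of basis states, partitioned into accepting, rejecting and non-halting states $Q_{\rm acc}, Q_{\rm rej}, Q_{\rm non}$; a starting state $q_0\in Q$; and, for each symbol $\sigma\in\Sigma\cup\{¢,\$\}$ (where $¢,\$\notin\Sigma$ are the left and right end markers), a unitary transformation $U_\sigma$ of $\mathbb{C}^Q$. On input $x\in\Sigma^*$ it starts in $|q_0\rangle$ and reads the symbols of $¢x\$$ one after another. Reading $\sigma$ in the state $|\psi\rangle$ means applying $U_\sigma$ and then measuring with respect to $E_{\rm acc}\oplus E_{\rm rej}\oplus E_{\rm non}$, where $E_i={\rm span}\{|q\rangle : q\in Q_i\}$: $E_i$ is observed with probability equal to the squared norm of the projection of $U_\sigma|\psi\rangle$ onto $E_i$, and the state becomes that projection, normalized. If $E_{\rm acc}$ (respectively $E_{\rm rej}$) is observed, the input is accepted (respectively rejected) and the computation halts; otherwise it continues with the next symbol, if any. The QFA *recognizes* a language $L\subseteq\Sigma^*$ *with probability* $p>\frac12$ if it accepts every word in $L$ with probability at least $p$ and rejects every word in $\Sigma^*\setminus L$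 with probability at least $p$. The size of a (deterministic or quantum) finite automaton is its number of (basis) states. **Theorem.** For $n\ge 1$ let $L_n=\{wa : w\in\{a,b\}^*,\ |w|\le n\}$, a language over the alphabet $\{a,b\}$. Then: 1. There is a constant $C$ such that for every $n\ge1$ the language $L_n$ is recognized by a 1-way deterministic finite automaton with at most $Cn$ states. 2. For every $n\ge 1$ and every $p$ with $\frac12<p\le 1$, the language $L_n$ is recognized with probability $p$ by some 1-way QFA. 3. For every constant $p>\frac12$ there is a constant $c>0$, depending only on $p$, such that for every $n\ge 2$, any 1-way QFA recognizing $L_n$ with probability $p$ has at least $2^{c\,n/\log_2 n}$ states. -/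

import Mathlib

/-- The two-letter input alphabet. -/
inductive Letter where
  | a
  | b

/-- The language `L_n = {wa : w ∈ {a,b}*, |w| ≤ n}`. -/
def langL (n : ℕ) : Language Letter :=
  {x | ∃ w : List Letter, w.length ≤ n ∧ x = w ++ [Letter.a]}

/-- The working alphabet: the input letters and the two end markers. -/
inductive WorkSymbol (α : Type) where
  | leftEnd
  | letter (s : α)
  | rightEnd

/-- The three parts into which the basis states are divided. -/
inductive StateKind where
  | acc
  | rej
  | non
  deriving DecidableEq

/-- A 1-way quantum finite automaton (with measurement after every symbol) over the input
alphabet `α` with basis states `Q`: the partition of `Q` into accepting, rejecting and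
non-halting states, the starting state, and a unitary transformation of `ℂ^Q` for every
symbol of the working alphabet. -/
structure QFA (α Q : Type) [Fintype Q] where
  kind : Q → StateKind
  start : Q
  U : WorkSymbol α → (EuclideanSpace ℂ Q ≃ₗᵢ[ℂ] EuclideanSpace ℂ Q)

namespace QFA

variable {α Q : Type} [Fintype Q]

/-- Orthogonal projection onto the span of the basis states of kind `k`. -/
noncomputable def proj (M : QFA α Q) (k : StateKind) (ψ : EuclideanSpace ℂ Q) :
    EuclideanSpace ℂ Q :=
  WithLp.toLp 2 fun q => if M.kind q = k then ψ q else 0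

/-- The probability that, started in the state `ψ` and reading the given symbols one after
another, the automaton halts by observing the halting kind `k` (`acc` or `rej`).
Reading a symbol applies its unitary and then measures; the observation `k'` has as its
probability the squared norm of the projection, and after the observation `non` the
computation continues in the projection normalized to a unit vector. -/
noncomputable def haltProb (M : QFA α Q) (k : StateKind) :
    EuclideanSpace ℂ Q → List (WorkSymbol α) → ℝ
  | _, [] => 0
  | ψ, s :: w =>
      ‖M.proj k (M.U s ψ)‖ ^ 2 +
        ‖M.proj StateKind.non (M.U s ψ)‖ ^ 2 *
          M.haltProb k (NormedSpace.normalize (M.proj StateKind.non (M.U s ψ))) w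

/-- The input word between its two end markers. -/
def tape (x : List α) : List (WorkSymbol α) :=
  WorkSymbol.leftEnd :: (x.map WorkSymbol.letter ++ [WorkSymbol.rightEnd])

open Classical in
/-- The starting superposition `|q₀⟩`. -/
noncomputable def startKet (M : QFA α Q) : EuclideanSpace ℂ Q :=
  EuclideanSpace.single M.start 1

/-- The probability that the word `x` is accepted. -/
noncomputable def acceptProb (M : QFA α Q) (x : List α) : ℝ :=
  M.haltProb StateKind.acc M.startKet (tape x)

/-- The probability that the word `x` is rejected. -/
noncomputable def rejectProb (M : QFA α Q) (x : List α) : ℝ :=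
  M.haltProb StateKind.rej M.startKet (tape x)

/-- `M` recognizes `L` with probability `p`: words in `L` are accepted, and words not in `L`
are rejected, with probability at least `p`. -/
def Recognizes (M : QFA α Q) (L : Language α) (p : ℝ) : Prop :=
  (∀ x, x ∈ L → p ≤ M.acceptProb x) ∧ (∀ x, x ∉ L → p ≤ M.rejectProb x)

end QFA

/-! ### A deterministic automaton -/

/-! Parts 1 and 2 are finite bookkeeping: a saturating letter counter, and a reversible automaton
whose basis states are tape prefixes.

For part 3, membership of a nonempty word of length at most `n + 1` depends only on its last letter.
So the automaton can be queried repeatedly: read the end marker, observe the verdict, undo the end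
marker and the last letter, and query again.

Undoing requires unitary evolution, so measurements are deferred: at each time the halted amplitude
is swapped into a fresh slot, and `QFA.norm_stored_simulate_sq` identifies the stored weight with
the halting probability. One query may disturb the state by a constant, so `k = O(log n)` copies are
kept and the query projects onto their majority verdict; by `norm_pureTensor_sub_majority_le` the
disturbance is then at most `1 / (2n)` per letter.

All `n` letters are thus recovered with constant amplitude. Since the decoders of all words together
satisfy `∑ ‖D_x v‖² ≤ ‖v‖²`, `two_pow_le_of_serial_decoding` bounds `2 ^ n` by four times the
dimension `(|Q| (n + 3)) ^ k`. Taking logarithms gives `log |Q| = Ω(n / log n)`. -/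

open Classical in
/-- The automaton counting the letters up to `n + 2` and remembering whether the last one
was `a`. -/
noncomputable def countingDFA (n : ℕ) : DFA Letter (Fin (n + 3) × Bool) where
  step q s := (⟨min (q.1 + 1) (n + 2), by omega⟩, decide (s = Letter.a))
  start := (0, false)
  accept := {q | (q.1 : ℕ) ≤ n + 1 ∧ q.2 = true}

theorem countingDFA_eval_fst (n : ℕ) (x : List Letter) :
    (((countingDFA n).eval x).1 : ℕ) = min x.length (n + 2) := by
  induction x using List.reverseRecOn with
  | nil => simp [countingDFA]
  | append_singleton x s ih =>
    rw [DFA.eval_append_singleton]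
    simp only [countingDFA, List.length_append, List.length_singleton] at ih ⊢
    omega

theorem mem_langL_append_singleton (n : ℕ) (x : List Letter) (s : Letter) :
    x ++ [s] ∈ langL n ↔ x.length ≤ n ∧ s = Letter.a := by
  constructor
  · rintro ⟨w, hw, h⟩
    obtain ⟨rfl, h⟩ := List.append_inj' h rfl
    exact ⟨hw, by simpa using h⟩
  · rintro ⟨h, rfl⟩
    exact ⟨x, h, rfl⟩

theorem length_le_of_mem_langL {n : ℕ} {x : List Letter} (h : x ∈ langL n) :
    x.length ≤ n + 1 := by
  obtain ⟨w, hw, rfl⟩ := h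
  simpa using hw

theorem countingDFA_accepts (n : ℕ) : (countingDFA n).accepts = langL n := by
  ext x
  rw [DFA.mem_accepts]
  rcases List.eq_nil_or_concat' x with rfl | ⟨x, s, rfl⟩
  · constructor
    · simp [countingDFA]
    · rintro ⟨w, -, h⟩
      simp at h
  · rw [mem_langL_append_singleton]
    have h1 := countingDFA_eval_fst n (x ++ [s])
    have h2 : ((countingDFA n).eval (x ++ [s])).2 = true ↔ s = Letter.a := by
      rw [DFA.eval_append_singleton]
      simp [countingDFA]
    change (_ ≤ n + 1 ∧ _ = true) ↔ _
    rw [h1, h2]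
    simp only [List.length_append, List.length_singleton]
    refine and_congr_left fun _ => ?_
    omega

/-! ### Reversible automata as quantum automata -/

namespace QFA

variable {α Q : Type} [Fintype Q]

/-- The quantum automaton whose transformations permute the basis states. -/
noncomputable def ofPerm (kind : Q → StateKind) (start : Q) (π : WorkSymbol α → Equiv.Perm Q) :
    QFA α Q where
  kind := kind
  start := start
  U s := LinearIsometryEquiv.piLpCongrLeft 2 ℂ ℂ (π s)

section ofPerm

variable (kind : Q → StateKind) (start : Q) (π : WorkSymbol α → Equiv.Perm Q)

/-- Basis states go to basis states, so each projection is either the whole unit vector or zero, and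
normalization changes nothing that counts. -/
theorem ofPerm_haltProb_cons [DecidableEq Q] (k : StateKind) (q : Q) (s : WorkSymbol α)
    (w : List (WorkSymbol α)) :
    (ofPerm kind start π).haltProb k (EuclideanSpace.single q 1) (s :: w) =
      (if kind (π s q) = k then 1 else 0) + (if kind (π s q) = StateKind.non then
        (ofPerm kind start π).haltProb k (EuclideanSpace.single (π s q) 1) w else 0) := by
  have hU : (ofPerm kind start π).U s (EuclideanSpace.single q 1) =
      EuclideanSpace.single (π s q) 1 := by
    simp only [ofPerm]
    exact LinearIsometryEquiv.piLpCongrLeft_single _ _ _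
  have hP : ∀ (j : StateKind) (r : Q), (ofPerm kind start π).proj j (EuclideanSpace.single r 1) =
      if kind r = j then EuclideanSpace.single r 1 else 0 := by
    intro j r
    ext x
    by_cases hx : x = r
    · subst hx
      by_cases h : kind x = j <;> simp [proj, ofPerm, h]
    · by_cases h : kind r = j <;> simp [proj, ofPerm, h, hx]
  rw [haltProb, hU, hP, hP]
  congr 1
  · split_ifs <;> simp
  · split_ifs <;> simp [NormedSpace.normalize]

end ofPerm

end QFA

/-! ### A quantum automaton without error -/

/-- Tape prefixes of bounded length. -/
abbrev BoundedTape (N : ℕ) : Type := {l : List (WorkSymbol Letter) // l.length ≤ N}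

instance : Finite (WorkSymbol Letter) :=
  Finite.of_injective
    (fun s : WorkSymbol Letter => match s with
      | .leftEnd => (0 : Fin 4)
      | .letter .a => 1
      | .letter .b => 2
      | .rightEnd => 3) (by
    intro s t h
    rcases s with _ | (_ | _) | _ <;> rcases t with _ | (_ | _) | _ <;> simp_all)

instance (N : ℕ) : Finite (BoundedTape N) := (List.finite_length_le _ N).to_subtype

/-- Appending a fixed symbol is injective, and a partial injection of a finite set extends to a
permutation. -/
theorem exists_perm_append (N : ℕ) (s : WorkSymbol Letter) :
    ∃ π : Equiv.Perm (BoundedTape N), ∀ l : BoundedTape N, l.1.length < N →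
      (π l).1 = l.1 ++ [s] := by
  classical
  let f : {l : BoundedTape N // l.1.length < N} → BoundedTape N :=
    fun l => ⟨l.1.1 ++ [s], by simpa using l.2⟩
  have hf : Function.Injective f := by
    intro l m h
    have h1 : l.1.1 ++ [s] = m.1.1 ++ [s] := congrArg Subtype.val h
    exact Subtype.ext (Subtype.ext (List.append_cancel_right h1))
  have := Fintype.ofFinite (BoundedTape N)
  let e := Equiv.ofInjective f hf
  refine ⟨e.extendSubtype, fun l hl => ?_⟩
  rw [Equiv.extendSubtype_apply_of_mem e l hl]
  rfl

open Classical in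
/-- The classification of tape prefixes: halt as soon as the answer is known from the right
end marker or from the length. -/
noncomputable def tapeKind (n : ℕ) (l : List (WorkSymbol Letter)) : StateKind :=
  if ∃ x ∈ langL n, l = QFA.tape x then StateKind.acc
  else if (∃ x, l = QFA.tape x) ∨ n + 3 ≤ l.length then StateKind.rej
  else StateKind.non

theorem leftEnd_cons_ne_tape (y x : List Letter) :
    WorkSymbol.leftEnd :: y.map WorkSymbol.letter ≠ QFA.tape x := by
  intro h
  rw [QFA.tape, List.cons.injEq] at h
  have h1 : WorkSymbol.rightEnd ∈ y.map WorkSymbol.letter := by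
    rw [h.2]
    simp
  simp at h1

theorem tape_injective : Function.Injective (QFA.tape (α := Letter)) := by
  intro x y h
  simp only [QFA.tape, List.cons.injEq, true_and] at h
  have h1 := List.append_cancel_right h
  exact List.map_injective_iff.2 (fun u v huv => by simpa using huv) h1

theorem tapeKind_prefix (n : ℕ) (y : List Letter) :
    tapeKind n (WorkSymbol.leftEnd :: y.map WorkSymbol.letter) =
      if n + 2 ≤ y.length then StateKind.rej else StateKind.non := by
  simp [tapeKind, leftEnd_cons_ne_tape]

open Classical in
theorem tapeKind_tape (n : ℕ) (x : List Letter) :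
    tapeKind n (QFA.tape x) = if x ∈ langL n then StateKind.acc else StateKind.rej := by
  have h : (∃ y ∈ langL n, QFA.tape x = QFA.tape y) ↔ x ∈ langL n :=
    ⟨fun ⟨y, hy, h⟩ => tape_injective h ▸ hy, fun h => ⟨x, h, rfl⟩⟩
  simp only [tapeKind, h]
  simp

/-- The run halts no later than on the tape prefix of length `n + 3`, so the arbitrary values of the
extended permutations on full-length prefixes are never used. -/
theorem exists_qfa_recognizes_langL (n : ℕ) :
    ∃ (Q : Type) (_ : Fintype Q) (M : QFA Letter Q), M.Recognizes (langL n) 1 := by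
  classical
  have := Fintype.ofFinite (BoundedTape (n + 3))
  choose π hπ using exists_perm_append (n + 3)
  let M : QFA Letter (BoundedTape (n + 3)) :=
    QFA.ofPerm (fun l => tapeKind n l.1) ⟨[], by simp⟩ π
  -- Induction on the unread part `z`, with `y` already read and the run not yet halted.
  have key : ∀ (z y : List Letter) (l : BoundedTape (n + 3)),
      l.1 = WorkSymbol.leftEnd :: y.map WorkSymbol.letter → y.length ≤ n + 1 →
      ∀ k, k = tapeKind n (QFA.tape (y ++ z)) →
      M.haltProb k (EuclideanSpace.single l 1)
        (z.map WorkSymbol.letter ++ [WorkSymbol.rightEnd]) = 1 := by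
    intro z
    induction z with
    | nil =>
      intro y l hl hy k hk
      have h1 := hπ WorkSymbol.rightEnd l (by simp [hl]; omega)
      have h2 : (π WorkSymbol.rightEnd l).1 = QFA.tape y := by rw [h1, hl]; rfl
      rw [List.append_nil] at hk
      simp only [M, List.map_nil, List.nil_append]
      rw [QFA.ofPerm_haltProb_cons, h2, if_pos hk.symm, tapeKind_tape]
      split_ifs <;> simp_all
    | cons s z ih =>
      intro y l hl hy k hk
      have h1 := hπ (WorkSymbol.letter s) l (by simp [hl]; omega)
      have h2 : (π (WorkSymbol.letter s) l).1 =
          WorkSymbol.leftEnd :: (y ++ [s]).map WorkSymbol.letter := by rw [h1, hl]; simp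
      simp only [M, List.map_cons, List.cons_append]
      rw [QFA.ofPerm_haltProb_cons, h2, tapeKind_prefix]
      by_cases hlen : n + 2 ≤ (y ++ [s]).length
      · have hnot : y ++ s :: z ∉ langL n := fun h => by
          have := length_le_of_mem_langL h
          simp at this hlen
          omega
        rw [tapeKind_tape, if_neg hnot] at hk
        rw [if_pos hlen, hk]
        simp
      · rw [if_neg hlen, if_pos rfl]
        have h3 := ih (y ++ [s]) _ h2 (by omega) k (by simpa using hk)
        simp only [M] at h3
        rw [h3, if_neg, zero_add]
        rw [hk, tapeKind_tape]
        split_ifs <;> simp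
  have main : ∀ x k, k = tapeKind n (QFA.tape x) →
      M.haltProb k M.startKet (QFA.tape x) = 1 := by
    intro x k hk
    have h1 := hπ WorkSymbol.leftEnd ⟨[], by simp⟩ (by simp)
    have h2 : (π WorkSymbol.leftEnd ⟨[], by simp⟩).1 =
        WorkSymbol.leftEnd :: ([] : List Letter).map WorkSymbol.letter := by rw [h1]; simp
    have h3 := key x [] _ h2 (by simp) k (by simpa using hk)
    have hs : M.startKet = EuclideanSpace.single ⟨[], by simp⟩ 1 := by
      unfold QFA.startKet
      congr!
    rw [hs, QFA.tape]
    simp only [M] at h3 ⊢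
    rw [QFA.ofPerm_haltProb_cons, h2, tapeKind_prefix, if_neg (by simp : ¬ n + 2 ≤ _),
      if_pos rfl, h3, if_neg, zero_add]
    rw [hk, tapeKind_tape]
    split_ifs <;> simp
  refine ⟨_, inferInstance, M, fun x hx => ?_, fun x hx => ?_⟩
  · exact (main x _ (by rw [tapeKind_tape, if_pos hx])).ge
  · exact (main x _ (by rw [tapeKind_tape, if_neg hx])).ge

/-! ### Tensor powers of vectors and isometries -/

section TensorPower

variable {B : Type} {k : ℕ}

/-- The product vector `u 0 ⊗ ⋯ ⊗ u (k - 1)`. -/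
noncomputable def pureTensor (u : Fin k → EuclideanSpace ℂ B) : EuclideanSpace ℂ (Fin k → B) :=
  WithLp.toLp 2 fun f => ∏ i, u i (f i)

@[simp] theorem pureTensor_apply (u : Fin k → EuclideanSpace ℂ B) (f : Fin k → B) :
    pureTensor u f = ∏ i, u i (f i) := rfl

variable [Fintype B]

theorem inner_pureTensor (u v : Fin k → EuclideanSpace ℂ B) :
    inner ℂ (pureTensor u) (pureTensor v) = ∏ i, inner ℂ (u i) (v i) := by
  classical
  simp only [PiLp.inner_apply, pureTensor_apply]
  rw [Finset.prod_univ_sum, Fintype.piFinset_univ]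
  refine Finset.sum_congr rfl fun f _ => ?_
  simp [Finset.prod_mul_distrib]

theorem norm_pureTensor (u : Fin k → EuclideanSpace ℂ B) :
    ‖pureTensor u‖ = ∏ i, ‖u i‖ := by
  have h := inner_pureTensor u u
  simp only [inner_self_eq_norm_sq_to_K, Finset.prod_pow] at h
  have h' : ‖pureTensor u‖ ^ 2 = (∏ i, ‖u i‖) ^ 2 := by exact_mod_cast h
  exact (pow_left_inj₀ (norm_nonneg _) (Finset.prod_nonneg fun _ _ => norm_nonneg _)
    two_ne_zero).1 h'

/-- The tensors of images of basis vectors are orthonormal, so they define an isometry on the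
product basis; expanding a product of sums gives its action on every pure tensor. -/
theorem exists_tensorPow (k : ℕ) (A : EuclideanSpace ℂ B ≃ₗᵢ[ℂ] EuclideanSpace ℂ B) :
    ∃ A' : EuclideanSpace ℂ (Fin k → B) →ₗᵢ[ℂ] EuclideanSpace ℂ (Fin k → B),
      ∀ u, A' (pureTensor u) = pureTensor fun i => A (u i) := by
  classical
  let e := EuclideanSpace.basisFun B ℂ
  let E := EuclideanSpace.basisFun (Fin k → B) ℂ
  let c : (Fin k → B) → EuclideanSpace ℂ (Fin k → B) := fun g => pureTensor fun i => A (e (g i))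
  have hc : Orthonormal ℂ c := by
    rw [orthonormal_iff_ite]
    intro g h
    simp only [c, inner_pureTensor, LinearIsometryEquiv.inner_map_map,
      orthonormal_iff_ite.1 e.orthonormal]
    rw [Finset.prod_ite_zero]
    simp [funext_iff]
  have hcE : (E.toBasis.constr ℂ c) ∘ E.toBasis = c := by
    funext g
    simp
  refine ⟨(E.toBasis.constr ℂ c).isometryOfOrthonormal (v := E.toBasis)
    (by simp) (by rw [hcE]; exact hc), fun u => ?_⟩
  have hA : ∀ (v : EuclideanSpace ℂ B) (x : B), A v x = ∑ y, v y * A (e y) x := by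
    intro v x
    conv_lhs => rw [← e.sum_repr v]
    simp [e, map_sum]
  ext h
  change E.toBasis.constr ℂ c (pureTensor u) h = _
  rw [Module.Basis.constr_apply_fintype, pureTensor_apply,
    Finset.prod_congr rfl fun i _ => hA (u i) (h i), Finset.prod_univ_sum, Fintype.piFinset_univ]
  simp [E, c, Finset.prod_mul_distrib]

end TensorPower

/-! ### Coordinate projections and majority votes -/

section Majority

variable {ι B : Type}

open Classical in
/-- Projection onto the span of the coordinates in `S`. -/
noncomputable def coordProj (S : Set ι) : EuclideanSpace ℂ ι →ₗ[ℂ] EuclideanSpace ℂ ι where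
  toFun v := WithLp.toLp 2 fun x => if x ∈ S then v x else 0
  map_add' v w := by ext x; by_cases h : x ∈ S <;> simp [h]
  map_smul' c v := by ext x; by_cases h : x ∈ S <;> simp [h]

open Classical in
@[simp] theorem coordProj_apply (S : Set ι) (v : EuclideanSpace ℂ ι) (x : ι) :
    coordProj S v x = if x ∈ S then v x else 0 := rfl

theorem norm_coordProj_sq_add_le [Fintype ι] {S S' : Set ι} (h : Disjoint S S') (v : EuclideanSpace ℂ ι) :
    ‖coordProj S v‖ ^ 2 + ‖coordProj S' v‖ ^ 2 ≤ ‖v‖ ^ 2 := by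
  classical
  simp only [EuclideanSpace.norm_sq_eq, ← Finset.sum_add_distrib, coordProj_apply]
  refine Finset.sum_le_sum fun x _ => ?_
  by_cases h1 : x ∈ S
  · simp [h1, Set.disjoint_left.1 h h1]
  · by_cases h2 : x ∈ S' <;> simp [h1, h2]

open Classical in
/-- The tuples with a strict majority of entries in `S`. -/
def majoritySet (k : ℕ) (S : Set B) : Set (Fin k → B) :=
  {f | k < 2 * (Finset.univ.filter fun i => f i ∈ S).card}

theorem disjoint_majoritySet (k : ℕ) {S S' : Set B} (h : Disjoint S S') :
    Disjoint (majoritySet k S) (majoritySet k S') := by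
  classical
  rw [Set.disjoint_left]
  intro f h1 h2
  simp only [majoritySet, Set.mem_ofPred_eq] at h1 h2
  have h3 : Disjoint (Finset.univ.filter fun i => f i ∈ S)
      (Finset.univ.filter fun i => f i ∈ S') := by
    rw [Finset.disjoint_filter]
    exact fun i _ hi => Set.disjoint_left.1 h hi
  have h4 := Finset.card_le_univ
    ((Finset.univ.filter fun i => f i ∈ S) ∪ (Finset.univ.filter fun i => f i ∈ S'))
  rw [Finset.card_union_of_disjoint h3, Fintype.card_fin] at h4
  omega

/-- Chernoff bound for the majority vote on `k` copies of a state. -/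
theorem norm_pureTensor_sub_majority_le [Fintype B] {p : ℝ} (hp : 1 / 2 < p) (k : ℕ) (S : Set B)
    (v : EuclideanSpace ℂ B) (hv : ‖v‖ = 1) (hS : p ≤ ‖coordProj S v‖ ^ 2) :
    ‖(pureTensor fun _ : Fin k => v) - coordProj (majoritySet k S) (pureTensor fun _ => v)‖ ^ 2
      ≤ (2 * p * (1 - p) + 1 / 2) ^ k := by
  classical
  have hp0 : 0 < p := by linarith
  -- Exponential tilting: a tuple without a majority in `S` has weight product at least `1`, while
  -- the mean weight of one entry is at most `2p - (2p - 1/(2p)) p = 2p(1 - p) + 1/2`.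
  let wt : B → ℝ := fun x => if x ∈ S then (2 * p)⁻¹ else 2 * p
  have hwt : ∀ x, 0 < wt x := fun x => by simp only [wt]; split_ifs <;> positivity
  have hterm : ∀ f : Fin k → B,
      ‖((pureTensor fun _ : Fin k => v) - coordProj (majoritySet k S) (pureTensor fun _ => v)) f‖ ^ 2
        ≤ ∏ i, ‖v (f i)‖ ^ 2 * wt (f i) := by
    intro f
    by_cases hf : f ∈ majoritySet k S
    · simp only [PiLp.sub_apply, coordProj_apply, hf, if_true, sub_self, norm_zero]
      rw [zero_pow two_ne_zero]
      exact Finset.prod_nonneg fun i _ => mul_nonneg (sq_nonneg _) (hwt _).le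
    · simp only [PiLp.sub_apply, coordProj_apply, hf, if_false, sub_zero, pureTensor_apply,
        norm_prod, Finset.prod_mul_distrib, Finset.prod_pow]
      refine le_mul_of_one_le_right (sq_nonneg _) ?_
      simp only [wt, Finset.prod_ite, Finset.prod_const]
      have hcard := Finset.card_filter_add_card_filter_not (s := (Finset.univ : Finset (Fin k)))
        (fun i => f i ∈ S)
      simp only [majoritySet, Set.mem_ofPred_eq, not_lt, Finset.card_univ, Fintype.card_fin]
        at hf hcard
      rw [inv_pow, inv_mul_eq_div, one_le_div (by positivity)]
      exact pow_le_pow_right₀ (by linarith) (by omega)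
  have hsum : ∑ x, ‖v x‖ ^ 2 = 1 := by rw [← EuclideanSpace.norm_sq_eq, hv, one_pow]
  have hS' : ‖coordProj S v‖ ^ 2 = ∑ x, if x ∈ S then ‖v x‖ ^ 2 else 0 := by
    rw [EuclideanSpace.norm_sq_eq]
    refine Finset.sum_congr rfl fun x _ => ?_
    by_cases h : x ∈ S <;> simp [h]
  have hone : ∑ x, ‖v x‖ ^ 2 * wt x ≤ 2 * p * (1 - p) + 1 / 2 := by
    have h1 : ∑ x, ‖v x‖ ^ 2 * wt x = 2 * p + ((2 * p)⁻¹ - 2 * p) * ‖coordProj S v‖ ^ 2 := by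
      rw [hS', Finset.mul_sum]
      have h0 : 2 * p = ∑ x, 2 * p * ‖v x‖ ^ 2 := by rw [← Finset.mul_sum, hsum, mul_one]
      nth_rewrite 1 [h0]
      rw [← Finset.sum_add_distrib]
      refine Finset.sum_congr rfl fun x _ => ?_
      by_cases h : x ∈ S <;> simp [wt, h] <;> ring
    have h2 : (2 * p)⁻¹ - 2 * p ≤ 0 := by
      have : (2 * p)⁻¹ ≤ 1 := inv_le_one_of_one_le₀ (by linarith)
      linarith
    have h3 : (2 * p)⁻¹ * p = 1 / 2 := by field_simp
    rw [h1]
    nlinarith [mul_le_mul_of_nonpos_left hS h2]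
  rw [EuclideanSpace.norm_sq_eq]
  calc _ ≤ ∑ f : Fin k → B, ∏ i, ‖v (f i)‖ ^ 2 * wt (f i) := Finset.sum_le_sum fun f _ => hterm f
    _ = ∏ _i : Fin k, ∑ x, ‖v x‖ ^ 2 * wt x := by
        rw [Finset.prod_univ_sum, Fintype.piFinset_univ]
    _ = (∑ x, ‖v x‖ ^ 2 * wt x) ^ k := by simp
    _ ≤ _ := pow_le_pow_left₀
        (Finset.sum_nonneg fun x _ => mul_nonneg (sq_nonneg _) (hwt x).le) hone k

end Majority

/-! ### Serial decoding -/

section Decoding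

variable {ι : Type} [Fintype ι]

/-- Cauchy–Schwarz: the Hilbert–Schmidt norm dominates the operator norm. -/
theorem norm_map_sq_le_sum_basis (A : EuclideanSpace ℂ ι →ₗ[ℂ] EuclideanSpace ℂ ι)
    (v : EuclideanSpace ℂ ι) :
    ‖A v‖ ^ 2 ≤ ‖v‖ ^ 2 * ∑ i, ‖A (EuclideanSpace.basisFun ι ℂ i)‖ ^ 2 := by
  have h : A v = ∑ i, v i • A (EuclideanSpace.basisFun ι ℂ i) := by
    conv_lhs => rw [← (EuclideanSpace.basisFun ι ℂ).sum_repr v]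
    simp [map_sum]
  calc ‖A v‖ ^ 2 ≤ (∑ i, ‖v i‖ * ‖A (EuclideanSpace.basisFun ι ℂ i)‖) ^ 2 := by
        refine pow_le_pow_left₀ (norm_nonneg _) ?_ 2
        rw [h]
        refine (norm_sum_le _ _).trans (le_of_eq ?_)
        simp [norm_smul]
    _ ≤ _ := by
        rw [EuclideanSpace.norm_sq_eq]
        exact Finset.sum_mul_sq_le_sq_mul_sq _ _ _

/-- Composition of the one-letter decoders along a word (last letter first). -/
noncomputable def serialDecoder (T : ℕ → Bool → EuclideanSpace ℂ ι →ₗ[ℂ] EuclideanSpace ℂ ι) :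
    List Bool → EuclideanSpace ℂ ι →ₗ[ℂ] EuclideanSpace ℂ ι
  | [] => LinearMap.id
  | s :: w => serialDecoder T w ∘ₗ T w.length s

/-- Each decoding step is a sub-measurement, and this property is inherited by their composition
over all words. -/
theorem sum_norm_serialDecoder_sq_le
    {T : ℕ → Bool → EuclideanSpace ℂ ι →ₗ[ℂ] EuclideanSpace ℂ ι}
    (hT : ∀ t v, ‖T t true v‖ ^ 2 + ‖T t false v‖ ^ 2 ≤ ‖v‖ ^ 2) (n : ℕ)
    (v : EuclideanSpace ℂ ι) :
    ∑ x : Fin n → Bool, ‖serialDecoder T (List.ofFn x) v‖ ^ 2 ≤ ‖v‖ ^ 2 := by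
  induction n generalizing v with
  | zero => simp [serialDecoder]
  | succ n ih =>
    rw [← (Fin.consEquiv fun _ : Fin (n + 1) => Bool).sum_comp, Fintype.sum_prod_type]
    have h : ∀ (s : Bool) (x : Fin n → Bool),
        serialDecoder T (List.ofFn (Fin.consEquiv (fun _ : Fin (n + 1) => Bool) (s, x))) v =
          serialDecoder T (List.ofFn x) (T n s v) := by
      intro s x
      have : List.ofFn (Fin.consEquiv (fun _ : Fin (n + 1) => Bool) (s, x)) = s :: List.ofFn x :=
        List.ofFn_cons s x
      rw [this, serialDecoder, LinearMap.comp_apply, List.length_ofFn]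
    simp only [h, Fintype.sum_bool]
    exact (add_le_add (ih _) (ih _)).trans (hT n v)

theorem norm_serialDecoder_le
    {T : ℕ → Bool → EuclideanSpace ℂ ι →ₗ[ℂ] EuclideanSpace ℂ ι}
    (hT : ∀ t v, ‖T t true v‖ ^ 2 + ‖T t false v‖ ^ 2 ≤ ‖v‖ ^ 2) (w : List Bool)
    (v : EuclideanSpace ℂ ι) : ‖serialDecoder T w v‖ ≤ ‖v‖ := by
  induction w generalizing v with
  | nil => simp [serialDecoder]
  | cons s w ih =>
    refine (ih _).trans ((sq_le_sq₀ (norm_nonneg _) (norm_nonneg _)).1 ?_)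
    have h := hT w.length v
    cases s
    · exact (le_add_of_nonneg_left (sq_nonneg _)).trans h
    · exact (le_add_of_nonneg_right (sq_nonneg _)).trans h

/-- Errors only add up, because the decoder still to be applied is a contraction. -/
theorem norm_serialDecoder_sub_le
    {T : ℕ → Bool → EuclideanSpace ℂ ι →ₗ[ℂ] EuclideanSpace ℂ ι}
    (hT : ∀ t v, ‖T t true v‖ ^ 2 + ‖T t false v‖ ^ 2 ≤ ‖v‖ ^ 2)
    {Φ : List Bool → EuclideanSpace ℂ ι} {n : ℕ} {δ : ℝ}
    (hδ : ∀ w s, w.length < n → ‖T w.length s (Φ (s :: w)) - Φ w‖ ≤ δ)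
    (w : List Bool) (hw : w.length ≤ n) :
    ‖serialDecoder T w (Φ w) - Φ []‖ ≤ w.length * δ := by
  induction w with
  | nil => simp [serialDecoder]
  | cons s w ih =>
    simp only [List.length_cons] at hw
    have h1 := ih (by omega)
    have h2 := (norm_serialDecoder_le hT w _).trans (hδ w s (by omega))
    rw [map_sub] at h2
    have h3 := norm_add_le (serialDecoder T w (T w.length s (Φ (s :: w))) - serialDecoder T w (Φ w))
      (serialDecoder T w (Φ w) - Φ [])
    rw [sub_add_sub_cancel] at h3
    simp only [serialDecoder, LinearMap.comp_apply, List.length_cons, Nat.cast_add, Nat.cast_one]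
    linarith

/-- If the letters of words of length `n`, encoded as unit vectors, can be read off one after the
other with small disturbance, then the dimension is at least a quarter of the number of words. -/
theorem two_pow_le_of_serial_decoding
    {T : ℕ → Bool → EuclideanSpace ℂ ι →ₗ[ℂ] EuclideanSpace ℂ ι}
    (hT : ∀ t v, ‖T t true v‖ ^ 2 + ‖T t false v‖ ^ 2 ≤ ‖v‖ ^ 2)
    {Φ : List Bool → EuclideanSpace ℂ ι} (hΦ : ∀ w, ‖Φ w‖ = 1) {n : ℕ} {δ : ℝ}
    (hδ : ∀ w s, w.length < n → ‖T w.length s (Φ (s :: w)) - Φ w‖ ≤ δ)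
    (hn : n * δ ≤ 1 / 2) : (2 : ℝ) ^ n ≤ 4 * Fintype.card ι := by
  -- Decoding its own code word leaves norm at least `1 - 1/2`, so each decoder has squared
  -- Hilbert–Schmidt norm at least `1/4`.
  have h1 : ∀ x : Fin n → Bool,
      1 / 4 ≤ ∑ i, ‖serialDecoder T (List.ofFn x) (EuclideanSpace.basisFun ι ℂ i)‖ ^ 2 := by
    intro x
    have h2 := norm_serialDecoder_sub_le hT hδ (List.ofFn x) (by simp)
    have h3 := norm_map_sq_le_sum_basis (serialDecoder T (List.ofFn x)) (Φ (List.ofFn x))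
    rw [hΦ, one_pow, one_mul] at h3
    rw [List.length_ofFn, norm_sub_rev] at h2
    have h4 := norm_sub_norm_le (Φ []) (serialDecoder T (List.ofFn x) (Φ (List.ofFn x)))
    rw [hΦ] at h4
    nlinarith
  -- After exchanging the sums, each basis vector contributes at most `1` over all words.
  have h5 : ∑ x : Fin n → Bool, (1 / 4 : ℝ) ≤ ∑ _i : ι, (1 : ℝ) := by
    refine (Finset.sum_le_sum fun x _ => h1 x).trans ?_
    rw [Finset.sum_comm]
    refine Finset.sum_le_sum fun i _ => (sum_norm_serialDecoder_sq_le hT n _).trans ?_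
    simp
  simp at h5
  linarith

end Decoding

/-! ### Coherent simulation of a quantum automaton -/

namespace QFA

variable {α Q : Type} [Fintype Q] (M : QFA α Q)

theorem norm_proj_sq (k : StateKind) (ψ : EuclideanSpace ℂ Q) :
    ‖M.proj k ψ‖ ^ 2 = ∑ q, if M.kind q = k then ‖ψ q‖ ^ 2 else 0 := by
  rw [EuclideanSpace.norm_sq_eq]
  refine Finset.sum_congr rfl fun q _ => ?_
  by_cases h : M.kind q = k <;> simp [proj, h]

theorem proj_smul (k : StateKind) (c : ℂ) (ψ : EuclideanSpace ℂ Q) :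
    M.proj k (c • ψ) = c • M.proj k ψ := by
  ext q
  by_cases h : M.kind q = k <;> simp [proj, h]

/-- The unnormalized non-halting state after reading the symbols. -/
noncomputable def live (ψ : EuclideanSpace ℂ Q) (l : List (WorkSymbol α)) : EuclideanSpace ℂ Q :=
  l.foldl (fun φ s => M.proj StateKind.non (M.U s φ)) ψ

/-- The halting probability computed from unnormalized states. -/
noncomputable def haltWeight (k : StateKind) : EuclideanSpace ℂ Q → List (WorkSymbol α) → ℝ
  | _, [] => 0
  | ψ, s :: w => ‖M.proj k (M.U s ψ)‖ ^ 2 + haltWeight k (M.proj StateKind.non (M.U s ψ)) w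

theorem haltWeight_smul (k : StateKind) (c : ℂ) (ψ : EuclideanSpace ℂ Q)
    (w : List (WorkSymbol α)) :
    M.haltWeight k (c • ψ) w = ‖c‖ ^ 2 * M.haltWeight k ψ w := by
  induction w generalizing ψ with
  | nil => simp [haltWeight]
  | cons s w ih => simp only [haltWeight, map_smul, proj_smul, ih, norm_smul]; ring

/-- The weight is homogeneous of degree two, so the normalization cancels against the probability
factor, also when the projection vanishes. -/
theorem haltProb_eq_haltWeight (k : StateKind) (ψ : EuclideanSpace ℂ Q)
    (w : List (WorkSymbol α)) : M.haltProb k ψ w = M.haltWeight k ψ w := by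
  induction w generalizing ψ with
  | nil => rfl
  | cons s w ih =>
    rw [haltProb, haltWeight, ih]
    congr 1
    generalize M.proj StateKind.non (M.U s ψ) = φ
    have h := M.haltWeight_smul k (‖φ‖ : ℂ) (NormedSpace.normalize φ) w
    have h' : (‖φ‖ : ℂ) • NormedSpace.normalize φ = φ := by
      rw [Complex.coe_smul]
      exact NormedSpace.norm_smul_normalize φ
    rw [h', Complex.norm_real, norm_norm] at h
    exact h.symm

theorem haltWeight_append_singleton (k : StateKind) (ψ : EuclideanSpace ℂ Q)
    (l : List (WorkSymbol α)) (s : WorkSymbol α) :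
    M.haltWeight k ψ (l ++ [s]) = M.haltWeight k ψ l + ‖M.proj k (M.U s (M.live ψ l))‖ ^ 2 := by
  induction l generalizing ψ with
  | nil => simp [haltWeight, live]
  | cons t l ih =>
    simp only [List.cons_append, haltWeight, ih, live, List.foldl_cons]
    ring

variable {J : Type}

/-- The part of a vector over `Q × Option J` in the working slot. -/
noncomputable def workSlot (v : EuclideanSpace ℂ (Q × Option J)) : EuclideanSpace ℂ Q :=
  WithLp.toLp 2 fun q => v (q, none)

variable [Fintype J]

/-- The transformation of a symbol acting on the working slot. -/
noncomputable def slotIsometry (s : WorkSymbol α) :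
    EuclideanSpace ℂ (Q × Option J) →ₗᵢ[ℂ] EuclideanSpace ℂ (Q × Option J) where
  toFun v := WithLp.toLp 2 fun x => x.2.elim (M.U s (workSlot v) x.1) fun _ => v x
  map_add' v w := by
    have h : workSlot (v + w) = workSlot v + workSlot w := rfl
    ext ⟨q, _ | j⟩ <;> simp [h]
  map_smul' c v := by
    have h : workSlot (c • v) = c • workSlot v := rfl
    ext ⟨q, _ | j⟩ <;> simp [h]
  norm_map' v := by
    have h := (M.U s).norm_map (workSlot v)
    rw [← sq_eq_sq₀ (norm_nonneg _) (norm_nonneg _), EuclideanSpace.norm_sq_eq,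
      EuclideanSpace.norm_sq_eq] at h ⊢
    simp only [Fintype.sum_prod_type, Fintype.sum_option, Finset.sum_add_distrib]
    simpa [workSlot] using h

open Classical in
/-- Exchange of the working slot and the slot `j` on the halting states. -/
noncomputable def storeEquiv (j : J) : Equiv.Perm (Q × Option J) where
  toFun x := (x.1, if M.kind x.1 = StateKind.non then x.2 else Equiv.swap none (some j) x.2)
  invFun x := (x.1, if M.kind x.1 = StateKind.non then x.2 else Equiv.swap none (some j) x.2)
  left_inv x := by by_cases h : M.kind x.1 = StateKind.non <;> simp [h]
  right_inv x := by by_cases h : M.kind x.1 = StateKind.non <;> simp [h]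

/-- Reading a symbol coherently: the halting part of the result is moved to the slot `j`. -/
noncomputable def stepEquiv (s : WorkSymbol α) (j : J) :
    EuclideanSpace ℂ (Q × Option J) ≃ₗᵢ[ℂ] EuclideanSpace ℂ (Q × Option J) :=
  ((M.slotIsometry s).toLinearIsometryEquiv rfl).trans
    (LinearIsometryEquiv.piLpCongrLeft 2 ℂ ℂ (M.storeEquiv j))

open Classical in
theorem stepEquiv_apply (s : WorkSymbol α) (j : J) (v : EuclideanSpace ℂ (Q × Option J))
    (q : Q) (x : Option J) :
    M.stepEquiv s j v (q, x) = M.slotIsometry s v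
      (q, if M.kind q = StateKind.non then x else Equiv.swap none (some j) x) := rfl

theorem slotIsometry_none (s : WorkSymbol α) (v : EuclideanSpace ℂ (Q × Option J)) (q : Q) :
    M.slotIsometry s v (q, none) = M.U s (workSlot v) q := rfl

theorem slotIsometry_some (s : WorkSymbol α) (v : EuclideanSpace ℂ (Q × Option J)) (q : Q)
    (i : J) : M.slotIsometry s v (q, some i) = v (q, some i) := rfl

theorem stepEquiv_some_of_ne (s : WorkSymbol α) {i j : J} (h : i ≠ j)
    (v : EuclideanSpace ℂ (Q × Option J)) (q : Q) :
    M.stepEquiv s j v (q, some i) = v (q, some i) := by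
  classical
  rw [stepEquiv_apply, Equiv.swap_apply_of_ne_of_ne (by simp) (by simpa using h), ite_self,
    slotIsometry_some]

theorem stepEquiv_some_self (s : WorkSymbol α) (j : J)
    (v : EuclideanSpace ℂ (Q × Option J)) {q : Q} (hq : M.kind q ≠ StateKind.non) :
    M.stepEquiv s j v (q, some j) = M.U s (workSlot v) q := by
  classical
  rw [stepEquiv_apply, if_neg hq, Equiv.swap_apply_right, slotIsometry_none]

/-- Because slot `j` is empty, the swap puts zeros in place of the halted amplitude, which is
exactly the non-halting projection. -/
theorem workSlot_stepEquiv (s : WorkSymbol α) (j : J)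
    (v : EuclideanSpace ℂ (Q × Option J)) (hv : ∀ q, v (q, some j) = 0) :
    workSlot (M.stepEquiv s j v) = M.proj StateKind.non (M.U s (workSlot v)) := by
  classical
  ext q
  change M.stepEquiv s j v (q, none) = if M.kind q = StateKind.non then _ else 0
  rw [stepEquiv_apply]
  by_cases h : M.kind q = StateKind.non
  · rw [if_pos h, if_pos h, slotIsometry_none]
  · rw [if_neg h, if_neg h, Equiv.swap_apply_left, slotIsometry_some, hv]

/-- The stored basis states of kind `k`. -/
def storedSet (J : Type) (k : StateKind) : Set (Q × Option J) := {x | M.kind x.1 = k ∧ x.2 ≠ none}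

theorem norm_stored_sq (k : StateKind) (v : EuclideanSpace ℂ (Q × Option J)) :
    ‖coordProj (M.storedSet J k) v‖ ^ 2 =
      ∑ i, ∑ q, if M.kind q = k then ‖v (q, some i)‖ ^ 2 else 0 := by
  classical
  rw [EuclideanSpace.norm_sq_eq, Fintype.sum_prod_type_right, Fintype.sum_option]
  simp only [coordProj_apply, storedSet, Set.mem_ofPred_eq]
  simp only [ne_eq, not_true, and_false, if_false, norm_zero, reduceCtorEq, not_false_eq_true,
    and_true]
  rw [zero_pow two_ne_zero, Finset.sum_const_zero, zero_add]
  refine Finset.sum_congr rfl fun i _ => Finset.sum_congr rfl fun q _ => ?_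
  split_ifs <;> simp

/-- The empty slot receives exactly the newly halted component, and the other slots are untouched.
-/
theorem norm_stored_stepEquiv_sq {k : StateKind} (hk : k ≠ StateKind.non) (s : WorkSymbol α)
    (j : J) (v : EuclideanSpace ℂ (Q × Option J)) (hv : ∀ q, v (q, some j) = 0) :
    ‖coordProj (M.storedSet J k) (M.stepEquiv s j v)‖ ^ 2 =
      ‖coordProj (M.storedSet J k) v‖ ^ 2 + ‖M.proj k (M.U s (workSlot v))‖ ^ 2 := by
  classical
  rw [norm_stored_sq, norm_stored_sq, norm_proj_sq, ← Finset.sum_erase_add _ _ (Finset.mem_univ j),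
    ← Finset.sum_erase_add (a := j) (s := (Finset.univ : Finset J)) (h := Finset.mem_univ j)
      (f := fun i => ∑ q, if M.kind q = k then ‖v (q, some i)‖ ^ 2 else 0)]
  have h0 : (∑ q, if M.kind q = k then ‖v (q, some j)‖ ^ 2 else 0) = 0 := by simp [hv]
  rw [h0, add_zero]
  congr 1
  · refine Finset.sum_congr rfl fun i hi => Finset.sum_congr rfl fun q _ => ?_
    rw [M.stepEquiv_some_of_ne s (Finset.ne_of_mem_erase hi)]
  · refine Finset.sum_congr rfl fun q _ => ?_
    split_ifs with hq
    · rw [M.stepEquiv_some_self s j v (by rw [hq]; exact hk)]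
    · rfl

/-- The coherent simulation on a reversed tape; at time `t` the slot `j t` is used. -/
noncomputable def simulate (j : ℕ → J) : List (WorkSymbol α) → EuclideanSpace ℂ (Q × Option J)
  | [] => WithLp.toLp 2 fun x => x.2.elim (M.startKet x.1) fun _ => 0
  | s :: l => M.stepEquiv s (j l.length) (simulate j l)

theorem norm_simulate (j : ℕ → J) (l : List (WorkSymbol α)) : ‖M.simulate j l‖ = 1 := by
  induction l with
  | nil =>
    have h : ‖M.startKet‖ = 1 := by simp [startKet]
    rw [← sq_eq_sq₀ (norm_nonneg _) zero_le_one, EuclideanSpace.norm_sq_eq]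
    rw [← sq_eq_sq₀ (norm_nonneg _) zero_le_one, EuclideanSpace.norm_sq_eq] at h
    simpa [simulate, Fintype.sum_prod_type, Fintype.sum_option] using h
  | cons s l ih => rw [simulate, LinearIsometryEquiv.norm_map, ih]

theorem simulate_some_eq_zero (j : ℕ → J) (l : List (WorkSymbol α)) (i : J)
    (hi : ∀ t < l.length, j t ≠ i) (q : Q) : M.simulate j l (q, some i) = 0 := by
  induction l with
  | nil => rfl
  | cons s l ih =>
    simp only [List.length_cons] at hi
    rw [simulate, M.stepEquiv_some_of_ne s (hi l.length (by omega)).symm]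
    exact ih fun t ht => hi t (by omega)

theorem workSlot_simulate {j : ℕ → J} {N : ℕ} (hj : Set.InjOn j (Set.Iio N))
    (l : List (WorkSymbol α)) (hl : l.length ≤ N) :
    workSlot (M.simulate j l) = M.live M.startKet l.reverse := by
  induction l with
  | nil => rfl
  | cons s l ih =>
    simp only [List.length_cons] at hl
    rw [simulate, M.workSlot_stepEquiv, ih (by omega), List.reverse_cons, live, live,
      List.foldl_append]
    · rfl
    · refine M.simulate_some_eq_zero j l _ fun t ht h => ?_
      have := hj (show t ∈ Set.Iio N by simp; omega) (show l.length ∈ Set.Iio N by simp; omega) h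
      omega

/-- Deferred measurement: distinct times use distinct slots, so halted amplitudes never interfere
and their weights add up to the halting probability. -/
theorem norm_stored_simulate_sq {j : ℕ → J} {N : ℕ} (hj : Set.InjOn j (Set.Iio N))
    {k : StateKind} (hk : k ≠ StateKind.non) (l : List (WorkSymbol α)) (hl : l.length ≤ N) :
    ‖coordProj (M.storedSet J k) (M.simulate j l)‖ ^ 2 = M.haltProb k M.startKet l.reverse := by
  rw [haltProb_eq_haltWeight]
  induction l with
  | nil =>
    rw [norm_stored_sq]
    simp [simulate, haltWeight]
  | cons s l ih =>
    simp only [List.length_cons] at hl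
    rw [simulate, M.norm_stored_stepEquiv_sq hk, ih (by omega), List.reverse_cons,
      haltWeight_append_singleton, M.workSlot_simulate hj l (by omega)]
    refine M.simulate_some_eq_zero j l _ fun t ht h => ?_
    have := hj (show t ∈ Set.Iio N by simp; omega) (show l.length ∈ Set.Iio N by simp; omega) h
    omega

theorem haltProb_eq_zero {k : StateKind} (h : ∀ q, M.kind q ≠ k) (ψ : EuclideanSpace ℂ Q)
    (w : List (WorkSymbol α)) : M.haltProb k ψ w = 0 := by
  induction w generalizing ψ with
  | nil => rfl
  | cons s w ih =>
    rw [haltProb, ih, norm_proj_sq]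
    simp [h]

end QFA

/-! ### The lower bound -/

/-- The letter encoded by a bit. -/
def bitLetter : Bool → Letter
  | true => Letter.a
  | false => Letter.b

/-- The verdict on words whose last letter is the given bit. -/
def bitKind : Bool → StateKind
  | true => StateKind.acc
  | false => StateKind.rej

/-- The reversed tape of a reversed word, without the right end marker. -/
def reversedTape (w : List Bool) : List (WorkSymbol Letter) :=
  w.map (fun s => WorkSymbol.letter (bitLetter s)) ++ [WorkSymbol.leftEnd]

theorem reverse_rightEnd_cons_reversedTape (w : List Bool) :
    (WorkSymbol.rightEnd :: reversedTape w).reverse = QFA.tape (w.reverse.map bitLetter) := by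
  simp [reversedTape, QFA.tape, Function.comp_def]

theorem QFA.Recognizes.le_haltProb {Q : Type} [Fintype Q] {M : QFA Letter Q} {n : ℕ} {p : ℝ}
    (hM : M.Recognizes (langL n) p) (w : List Bool) (hw : w.length ≤ n) (s : Bool) :
    p ≤ M.haltProb (bitKind s) M.startKet (QFA.tape ((s :: w).reverse.map bitLetter)) := by
  have h := mem_langL_append_singleton n (w.reverse.map bitLetter) (bitLetter s)
  rw [List.reverse_cons, List.map_append, List.map_singleton]
  cases s
  · exact hM.2 _ (by rw [h]; simp [bitLetter])
  · exact hM.1 _ (by rw [h]; simpa [bitLetter] using hw)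

/-- Serial decoding of `k` parallel coherent simulations; `n + 3` counts the working slot and `n +
2` storage slots. -/
theorem QFA.Recognizes.two_pow_le {Q : Type} [Fintype Q] {M : QFA Letter Q} {n : ℕ} {p : ℝ}
    (hp : 1 / 2 < p) (hM : M.Recognizes (langL n) p) (k : ℕ)
    (hk : n * √((2 * p * (1 - p) + 1 / 2) ^ k) ≤ 1 / 2) :
    (2 : ℝ) ^ n ≤ 4 * ((Fintype.card Q : ℝ) * (n + 3)) ^ k := by
  classical
  -- At most `n` letters and two end markers are read, so every time has its own slot.
  let J := Fin (n + 2)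
  let j : ℕ → J := Fin.ofNat (n + 2)
  have hj : Set.InjOn j (Set.Iio (n + 2)) := by
    intro s hs t ht h
    have h' := congrArg Fin.val h
    simp only [j, Fin.val_ofNat] at h'
    rwa [Nat.mod_eq_of_lt hs, Nat.mod_eq_of_lt ht] at h'
  -- With `t` letters read after the left marker, the next letter comes at time `t + 1` and the
  -- right marker after it at time `t + 2`.
  let W : ℕ → Bool → (EuclideanSpace ℂ (Q × Option J) ≃ₗᵢ[ℂ] EuclideanSpace ℂ (Q × Option J)) :=
    fun t s => M.stepEquiv (WorkSymbol.letter (bitLetter s)) (j (t + 1))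
  let E : ℕ → (EuclideanSpace ℂ (Q × Option J) ≃ₗᵢ[ℂ] EuclideanSpace ℂ (Q × Option J)) :=
    fun t => M.stepEquiv WorkSymbol.rightEnd (j (t + 2))
  choose P hP using exists_tensorPow (B := Q × Option J) k
  -- Read the end marker on all copies, project onto the majority verdict, then undo the end marker
  -- and the letter `s`.
  let T : ℕ → Bool → EuclideanSpace ℂ (Fin k → Q × Option J) →ₗ[ℂ]
      EuclideanSpace ℂ (Fin k → Q × Option J) := fun t s =>
    (P ((W t s).trans (E t)).symm).toLinearMap ∘ₗ
      coordProj (majoritySet k (M.storedSet J (bitKind s))) ∘ₗ (P (E t)).toLinearMap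
  let Φ : List Bool → EuclideanSpace ℂ (Fin k → Q × Option J) :=
    fun w => pureTensor fun _ => M.simulate j (reversedTape w)
  have hdisj : Disjoint (M.storedSet J (bitKind true)) (M.storedSet J (bitKind false)) := by
    rw [Set.disjoint_left]
    rintro x ⟨h1, -⟩ ⟨h2, -⟩
    rw [h1] at h2
    simp [bitKind] at h2
  have hT : ∀ t v, ‖T t true v‖ ^ 2 + ‖T t false v‖ ^ 2 ≤ ‖v‖ ^ 2 := by
    intro t v
    simp only [T, LinearMap.comp_apply, LinearIsometry.coe_toLinearMap, LinearIsometry.norm_map]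
    refine (norm_coordProj_sq_add_le (disjoint_majoritySet k hdisj) _).trans ?_
    rw [LinearIsometry.norm_map]
  have hΦ : ∀ w, ‖Φ w‖ = 1 := fun w => by simp [Φ, norm_pureTensor, M.norm_simulate]
  have hδ : ∀ w s, w.length < n →
      ‖T w.length s (Φ (s :: w)) - Φ w‖ ≤ √((2 * p * (1 - p) + 1 / 2) ^ k) := by
    intro w s hw
    have hlen : (reversedTape w).length = w.length + 1 := by simp [reversedTape]
    have hlen' : (reversedTape (s :: w)).length = w.length + 2 := by simp [reversedTape]
    set χ := M.simulate j (WorkSymbol.rightEnd :: reversedTape (s :: w)) with hχ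
    have hE : E w.length (M.simulate j (reversedTape (s :: w))) = χ := by
      rw [hχ, QFA.simulate, hlen']
    have hW : W w.length s (M.simulate j (reversedTape w)) =
        M.simulate j (reversedTape (s :: w)) := by
      change _ = M.stepEquiv _ (j (reversedTape w).length) (M.simulate j (reversedTape w))
      rw [hlen]
    have hback : ((W w.length s).trans (E w.length)).symm χ = M.simulate j (reversedTape w) := by
      rw [LinearIsometryEquiv.symm_apply_eq, LinearIsometryEquiv.trans_apply, hW, hE]
    -- `Φ w` is the image of the undisturbed queried state under the isometry that ends `T`, so the
    -- error of `T` is exactly the majority projection error.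
    have hΦw : Φ w = P ((W w.length s).trans (E w.length)).symm (pureTensor fun _ => χ) := by
      rw [hP, hback]
    have hTΦ : T w.length s (Φ (s :: w)) - Φ w =
        P ((W w.length s).trans (E w.length)).symm
          (coordProj (majoritySet k (M.storedSet J (bitKind s))) (pureTensor fun _ => χ)
            - pureTensor fun _ => χ) := by
      rw [map_sub, ← hΦw]
      simp only [T, Φ, LinearMap.comp_apply, LinearIsometry.coe_toLinearMap]
      rw [hP (E w.length), hE]
    rw [hTΦ, LinearIsometry.norm_map, norm_sub_rev]
    refine Real.le_sqrt_of_sq_le ?_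
    refine norm_pureTensor_sub_majority_le hp k _ χ (M.norm_simulate j _) ?_
    rw [hχ, M.norm_stored_simulate_sq hj (by cases s <;> simp [bitKind])
      _ (by simp [reversedTape]; omega), reverse_rightEnd_cons_reversedTape]
    exact hM.le_haltProb w hw.le s
  have h := two_pow_le_of_serial_decoding hT hΦ hδ hk
  simpa [J, add_assoc, show (2 : ℝ) + 1 = 3 by norm_num] using h

/-- The words `a` and `b` need opposite verdicts, so both halting kinds occur. This settles the
small `n`. -/
theorem QFA.Recognizes.two_le_card {Q : Type} [Fintype Q] {M : QFA Letter Q} {n : ℕ} {p : ℝ}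
    (hp : 1 / 2 < p) (hM : M.Recognizes (langL n) p) : 2 ≤ Fintype.card Q := by
  by_contra hcard
  have hsub : Subsingleton Q := Fintype.card_le_one_iff_subsingleton.1 (by omega)
  have h : ∀ s, ∃ q, M.kind q = bitKind s := by
    intro s
    by_contra! hs
    have h1 := hM.le_haltProb [] (by simp) s
    rw [M.haltProb_eq_zero hs] at h1
    linarith
  obtain ⟨q, hq⟩ := h true
  obtain ⟨r, hr⟩ := h false
  rw [Subsingleton.elim q r, hr] at hq
  simp [bitKind] at hq

/-! ### Choice of parameters and asymptotics -/

theorem QFA.Recognizes.mono {α Q : Type} [Fintype Q] {M : QFA α Q} {L : Language α} {p p' : ℝ}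
    (hM : M.Recognizes L p) (h : p' ≤ p) : M.Recognizes L p' :=
  ⟨fun x hx => h.trans (hM.1 x hx), fun x hx => h.trans (hM.2 x hx)⟩

/-- A number of copies logarithmic in `n` makes the majority vote reliable. -/
theorem exists_copies {r : ℝ} (hr0 : 0 < r) (hr1 : r < 1) :
    ∃ K : ℝ, 0 < K ∧ ∀ n : ℕ, 2 ≤ n →
      ∃ k : ℕ, (k : ℝ) ≤ K * Real.logb 2 n ∧ n * √(r ^ k) ≤ 1 / 2 := by
  have hρ : 0 < -Real.logb 2 r := by
    rw [neg_pos]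
    exact Real.logb_neg (by norm_num) hr0 hr1
  set ρ := -Real.logb 2 r with hρdef
  -- The goal `r ^ k ≤ (1 / (2n))²` means `k ρ ≥ 2 L + 2` with `L = logb 2 n`. As `L ≥ 1`, `4 / ρ`
  -- covers the quotient and `1` covers the rounding up.
  refine ⟨4 / ρ + 1, by positivity, fun n hn => ?_⟩
  have hn0 : (0 : ℝ) < n := by positivity
  have hL : 1 ≤ Real.logb 2 n := by
    rw [Real.le_logb_iff_rpow_le (by norm_num) hn0]
    simpa using (by exact_mod_cast hn : (2 : ℝ) ≤ n)
  set L := Real.logb 2 n with hLdef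
  refine ⟨⌈(2 * L + 2) / ρ⌉₊, ?_, ?_⟩
  · have h1 := (Nat.ceil_lt_add_one (show 0 ≤ (2 * L + 2) / ρ by positivity)).le
    have h2 : (2 * L + 2) / ρ ≤ 4 * L / ρ := by gcongr; linarith
    have h3 : (4 / ρ + 1) * L = 4 * L / ρ + L := by ring
    linarith
  · set k := ⌈(2 * L + 2) / ρ⌉₊
    have h1 : 2 * L + 2 ≤ k * ρ := by
      rw [← div_le_iff₀ hρ]
      exact Nat.le_ceil _
    have h2 : r ^ k ≤ (1 / (2 * n)) ^ 2 := by
      rw [← Real.logb_le_logb (b := 2) (by norm_num) (by positivity) (by positivity),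
        Real.logb_pow, Real.logb_pow, one_div, Real.logb_inv, Real.logb_mul (by norm_num) hn0.ne',
        Real.logb_self_eq_one (by norm_num), ← hLdef]
      push_cast
      rw [hρdef] at h1
      linarith
    have h3 : √(r ^ k) ≤ 1 / (2 * n) := Real.sqrt_le_iff.2 ⟨by positivity, h2⟩
    calc n * √(r ^ k) ≤ n * (1 / (2 * n)) := by gcongr
      _ = 1 / 2 := by field_simp

/-- Absorbs into `n / 2` the losses from the factor `4` and from the storage slots. -/
theorem eventually_two_add_mul_logb_sq_le (K : ℝ) :
    ∃ N : ℕ, ∀ n : ℕ, N ≤ n → 2 + 3 * K * Real.logb 2 n ^ 2 ≤ (n : ℝ) / 2 := by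
  have h1 : Filter.Tendsto (fun x : ℝ => Real.log x ^ 2 / x) Filter.atTop (nhds 0) := by
    simpa using Real.tendsto_pow_log_div_mul_add_atTop 1 0 2 one_ne_zero
  have h2 : Filter.Tendsto (fun x : ℝ => 2 / x + 3 * K / Real.log 2 ^ 2 * (Real.log x ^ 2 / x))
      Filter.atTop (nhds 0) := by
    simpa using (tendsto_const_nhds.div_atTop Filter.tendsto_id : Filter.Tendsto
      (fun x : ℝ => 2 / x) Filter.atTop (nhds 0)).add (h1.const_mul (3 * K / Real.log 2 ^ 2))
  have h3 := (h2.eventually (gt_mem_nhds (show (0 : ℝ) < 1 / 2 by norm_num))).and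
    (Filter.eventually_gt_atTop 0)
  obtain ⟨N, hN⟩ := Filter.eventually_atTop.1 (tendsto_natCast_atTop_atTop.eventually h3)
  refine ⟨N, fun n hn => ?_⟩
  obtain ⟨h4, h5⟩ := hN n hn
  have h6 : 2 + 3 * K * Real.logb 2 n ^ 2 =
      (2 / n + 3 * K / Real.log 2 ^ 2 * (Real.log n ^ 2 / n)) * (n : ℝ) := by
    rw [Real.logb]
    field_simp
  rw [h6]
  nlinarith

theorem exists_two_rpow_le_card {p : ℝ} (hp : 1 / 2 < p) (hp1 : p ≤ 1) :
    ∃ c : ℝ, 0 < c ∧ ∀ n : ℕ, 2 ≤ n → ∀ (Q : Type) [Fintype Q] (M : QFA Letter Q),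
      M.Recognizes (langL n) p →
        (2 : ℝ) ^ (c * ((n : ℝ) / Real.logb 2 (n : ℝ))) ≤ (Fintype.card Q : ℝ) := by
  obtain ⟨K, hK, hcopies⟩ := exists_copies (r := 2 * p * (1 - p) + 1 / 2)
    (by nlinarith) (by nlinarith)
  obtain ⟨N, hN⟩ := eventually_two_add_mul_logb_sq_le K
  -- The first constant serves `n ≥ N`; the second makes the exponent at most `1` for `n < N`, where
  -- two states suffice.
  refine ⟨min (1 / (2 * K)) (1 / (N + 1)), by positivity, fun n hn Q _ M hM => ?_⟩
  have hn2 : (2 : ℝ) ≤ n := by exact_mod_cast hn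
  have hn0 : (0 : ℝ) < n := by linarith
  have hL : 1 ≤ Real.logb 2 n := by
    rw [Real.le_logb_iff_rpow_le (by norm_num) hn0]
    simpa using hn2
  have hd : (2 : ℝ) ≤ Fintype.card Q := by exact_mod_cast hM.two_le_card hp
  rw [← Real.le_logb_iff_rpow_le (by norm_num) (by linarith)]
  rcases le_or_gt N n with hNn | hNn
  · obtain ⟨k, hkK, hk⟩ := hcopies n hn
    have h1 := hM.two_pow_le hp k hk
    set d : ℝ := (Fintype.card Q : ℝ)
    have h2 : (n : ℝ) ≤ 2 + k * (Real.logb 2 d + Real.logb 2 (n + 3)) := by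
      have h3 := (Real.logb_le_logb (b := 2) (by norm_num) (by positivity) (by positivity)).2 h1
      rw [Real.logb_pow, Real.logb_self_eq_one (by norm_num),
        Real.logb_mul (by norm_num) (by positivity), Real.logb_pow,
        Real.logb_mul (by positivity) (by positivity)] at h3
      have h4 : Real.logb 2 4 = 2 := by
        rw [show (4 : ℝ) = 2 ^ 2 by norm_num, Real.logb_pow, Real.logb_self_eq_one (by norm_num)]
        norm_num
      linarith
    have h5 : Real.logb 2 (n + 3) ≤ 3 * Real.logb 2 n := by
      have h6 : (n : ℝ) + 3 ≤ n ^ 3 := by nlinarith [mul_nonneg hn0.le (sub_nonneg.2 hn2)]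
      have h7 := (Real.logb_le_logb (b := 2) (by norm_num) (by positivity) (by positivity)).2 h6
      rw [Real.logb_pow] at h7
      exact_mod_cast h7
    have hd0 : 0 ≤ Real.logb 2 d := Real.logb_nonneg (by norm_num) (by linarith)
    have h8 := hN n hNn
    set L := Real.logb 2 n
    have h9 : k * (Real.logb 2 d + Real.logb 2 (n + 3)) ≤ K * L * (Real.logb 2 d + 3 * L) := by
      have h3 : 0 ≤ Real.logb 2 ((n : ℝ) + 3) := Real.logb_nonneg (by norm_num) (by linarith)
      gcongr
    have h10 : (n : ℝ) / 2 ≤ K * L * Real.logb 2 d := by nlinarith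
    calc min (1 / (2 * K)) (1 / (N + 1)) * ((n : ℝ) / L) ≤ 1 / (2 * K) * (n / L) := by
          gcongr
          exact min_le_left _ _
      _ = (n / 2) / (K * L) := by field_simp
      _ ≤ Real.logb 2 d := by
          rw [div_le_iff₀ (by positivity)]
          linarith
  · have h1 : (1 : ℝ) ≤ Real.logb 2 (Fintype.card Q) := by
      rw [Real.le_logb_iff_rpow_le (by norm_num) (by linarith)]
      simpa using hd
    refine le_trans ?_ h1
    have h2 : (n : ℝ) ≤ N + 1 := by
      have : n ≤ N + 1 := by omega
      exact_mod_cast this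
    calc min (1 / (2 * K)) (1 / (N + 1)) * ((n : ℝ) / Real.logb 2 n)
        ≤ 1 / (N + 1) * (n : ℝ) := by
          gcongr
          · exact min_le_right _ _
          · exact div_le_self hn0.le hL
      _ ≤ 1 := by
          rw [one_div, inv_mul_le_iff₀ (by positivity)]
          linarith

theorem mainTheorem3 :
    (∃ C : ℕ, ∀ n : ℕ, 1 ≤ n →
      ∃ (σ : Type) (_ : Fintype σ) (A : DFA Letter σ),
        A.accepts = langL n ∧ Fintype.card σ ≤ C * n) ∧
    (∀ p : ℝ, 1 / 2 < p → p ≤ 1 → ∀ n : ℕ, 1 ≤ n →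
      ∃ (Q : Type) (_ : Fintype Q) (M : QFA Letter Q), M.Recognizes (langL n) p) ∧
    (∀ p : ℝ, 1 / 2 < p → ∃ c : ℝ, 0 < c ∧ ∀ n : ℕ, 2 ≤ n →
      ∀ (Q : Type) [Fintype Q] (M : QFA Letter Q), M.Recognizes (langL n) p →
        (2 : ℝ) ^ (c * ((n : ℝ) / Real.logb 2 (n : ℝ))) ≤ (Fintype.card Q : ℝ)) := by
  refine ⟨⟨8, fun n hn => ?_⟩, fun p _ hp1 n _ => ?_, fun p hp => ?_⟩
  · refine ⟨_, inferInstance, countingDFA n, countingDFA_accepts n, ?_⟩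
    simp only [Fintype.card_prod, Fintype.card_fin, Fintype.card_bool]
    omega
  · obtain ⟨Q, hQ, M, hM⟩ := exists_qfa_recognizes_langL n
    exact ⟨Q, hQ, M, hM.mono hp1⟩
  -- Capping `p` at `1` keeps the Chernoff base `2p(1 - p) + 1/2` positive.
  · obtain ⟨c, hc, h⟩ := exists_two_rpow_le_card (p := min p 1) (lt_min hp (by norm_num))
      (min_le_right _ _)
    exact ⟨c, hc, fun n hn Q _ M hM => h n hn Q M (hM.mono (min_le_left _ _))⟩
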